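/- Let $E$ be a finite-dimensional complex Hilbert space, let $\mathbb T$ be the unit circle with normalized arc length, and let $L^2(E)$, $L^2(\mathcal L(E))$ be the spaces of square-integrable $E$-valued, respectively $\mathcal L(E)$-valued, functions on $\mathbb T$; $H^2(E)$ and $H^2(\mathcal L(E))$ denote their subspaces of functions whose Fourier coefficients of negative index vanish. Let $\Theta$ be an inner function, i.e. $\Theta\in H^2(\mathcal L(E))$ with $\Theta(e^{it})$ unitary for a.e. $t$, let $\mathcal K_\Theta=H^2(E)\ominus\Theta H^2(E)$, and let $P_\Theta$ be the orthogonal projection of $L^2(E)$ onto $\mathcal K_\Theta$. Let $\Phi\in L^2(\mathcal L(E))$ be such that the map $f\mapsto P_\Theta(\Phi f)$, defined on the (dense) subspace of essentially bounded functions in $\mathcal K_\Theta$, is bounded, and let $A_\Phi$ denote the bounded operator on $\mathcal K_\Theta$ that extends it (the matrix-valued truncated Toeplitz operator with symbol $\Phi$). A conjugation on a Hilbert space is a conjugate-linear, isometric and involutive map $C$; a bounded operator $T$ is $C$-symmetric if $T=CT^*C$. **Theorem.** Let $\Gamma$ be a conjugation on $E$, and define $C_\Gamma$ on $L^2(E)$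 by $(C_\Gamma f)(z)=\Theta(z)\,\bar z\,\Gamma(f(z))$, $z\in\mathbb T$. Suppose that for almost every $t$ the operators $\Theta(e^{it})$ and $\Phi(e^{it})$ are $\Gamma$-symmetric and $\Phi(e^{it})\Theta(e^{it})=\Theta(e^{it})\Phi(e^{it})$. Then $C_\Gamma$ restricts to a conjugation on $\mathcal K_\Theta$, and $A_\Phi$ is $C_\Gamma$-symmetric: $A_\Phi=C_\Gamma A_\Phi^*C_\Gamma$ on $\mathcal K_\Theta$. -/

import Mathlib

open MeasureTheory
open scoped InnerProductSpace

noncomputable section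

namespace MTTO

/-- A conjugation on a Hilbert space: a conjugate-linear, isometric, involutive map. -/
structure Conjugation (H : Type*) [NormedAddCommGroup H] [InnerProductSpace ℂ H]
    extends H →ₗᵢ⋆[ℂ] H where
  involutive : Function.Involutive toFun

instance {H : Type*} [NormedAddCommGroup H] [InnerProductSpace ℂ H] :
    CoeFun (Conjugation H) (fun _ => H → H) := ⟨fun C => C.toLinearIsometry⟩

/-- A bounded operator `T` is `C`-symmetric if `T = C T* C`. -/
def Conjugation.IsSymmetric {H : Type*} [NormedAddCommGroup H] [InnerProductSpace ℂ H]
    [CompleteSpace H] (C : Conjugation H) (T : H →L[ℂ] H) : Prop :=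
  ∀ x, T x = C (ContinuousLinearMap.adjoint T (C x))

instance factTwoPiPos : Fact (0 < 2 * Real.pi) := ⟨Real.two_pi_pos⟩

/-- The circle, a point `t` standing for `e^{it}`. -/
abbrev Circ : Type := AddCircle (2 * Real.pi)

/-- Normalized arc length `dt / 2π`. -/
abbrev arc : Measure Circ := AddCircle.haarAddCircle

/-- `L²(F)` on the circle; both `L²(E)` and `L²(𝓛(E))` are instances (on `𝓛(E)`, the operator norm
and the Hilbert–Schmidt norm are equivalent, so that the same functions are square integrable). -/
abbrev L2 (F : Type*) [NormedAddCommGroup F] : Type _ := Lp F 2 arc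

theorem norm_fourier_apply (n : ℤ) (t : Circ) : ‖(fourier n t : ℂ)‖ = 1 := by
  rw [fourier_apply]
  exact Circle.norm_coe _

section Fourier

variable {F : Type*} [NormedAddCommGroup F] [NormedSpace ℂ F]

theorem integrable_fourier_smul (f : L2 F) (n : ℤ) :
    Integrable (fun t => fourier n t • f t) arc := by
  have hf : Integrable (f : Circ → F) arc := (Lp.memLp f).integrable one_le_two
  refine hf.norm.mono' ?_ ?_
  · exact (map_continuous (fourier n)).aestronglyMeasurable.smul hf.aestronglyMeasurable
  · filter_upwards with t
    rw [norm_smul, norm_fourier_apply, one_mul]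

theorem fourierCoeff_add (f g : L2 F) (n : ℤ) :
    fourierCoeff (f + g : L2 F) n = fourierCoeff f n + fourierCoeff g n := by
  unfold fourierCoeff
  rw [← integral_add (integrable_fourier_smul f _) (integrable_fourier_smul g _)]
  refine integral_congr_ae ?_
  filter_upwards [Lp.coeFn_add f g] with t ht
  rw [ht, Pi.add_apply, smul_add]

theorem fourierCoeff_smul (c : ℂ) (f : L2 F) (n : ℤ) :
    fourierCoeff (c • f : L2 F) n = c • fourierCoeff f n := by
  unfold fourierCoeff
  rw [← integral_smul]
  refine integral_congr_ae ?_
  filter_upwards [Lp.coeFn_smul c f] with t ht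
  rw [ht, Pi.smul_apply, smul_comm]

theorem norm_fourierCoeff_le (f : L2 F) (n : ℤ) : ‖fourierCoeff f n‖ ≤ ‖f‖ := by
  have hf : MemLp (f : Circ → F) 2 arc := Lp.memLp f
  have h1 : ‖fourierCoeff f n‖ ≤ ∫ t, ‖f t‖ ∂arc := by
    refine (norm_integral_le_integral_norm _).trans (le_of_eq ?_)
    refine integral_congr_ae ?_
    filter_upwards with t
    rw [norm_smul, norm_fourier_apply, one_mul]
  refine h1.trans ?_
  rw [Lp.norm_def, integral_norm_eq_lintegral_enorm hf.1, ← eLpNorm_one_eq_lintegral_enorm]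
  exact ENNReal.toReal_mono hf.2.ne (eLpNorm_le_eLpNorm_of_exponent_le one_le_two hf.1)

/-- The `n`-th Fourier coefficient as a continuous linear map on `L²(F)`. -/
def coeffCLM (F : Type*) [NormedAddCommGroup F] [NormedSpace ℂ F] (n : ℤ) : L2 F →L[ℂ] F :=
  LinearMap.mkContinuous
    { toFun := fun f => fourierCoeff f n
      map_add' := fun f g => fourierCoeff_add f g n
      map_smul' := fun c f => fourierCoeff_smul c f n } 1
    (fun f => by simpa using norm_fourierCoeff_le f n)

/-- The Hardy space `H²(F)`: the functions in `L²(F)` whose negative Fourier coefficients vanish. -/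
def hardy (F : Type*) [NormedAddCommGroup F] [NormedSpace ℂ F] : Submodule ℂ (L2 F) where
  carrier := {f | ∀ n : ℤ, n < 0 → fourierCoeff f n = 0}
  add_mem' := fun {f g} hf hg n hn => by rw [fourierCoeff_add, hf n hn, hg n hn, add_zero]
  zero_mem' := fun n _ => (coeffCLM F n).map_zero
  smul_mem' := fun c f hf n hn => by rw [fourierCoeff_smul, hf n hn, smul_zero]

theorem isClosed_hardy : IsClosed (hardy F : Set (L2 F)) := by
  have : (hardy F : Set (L2 F)) = ⋂ n : ℤ, ⋂ _ : n < 0, {f | coeffCLM F n f = 0} := by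
    ext f
    simp only [Set.mem_iInter]
    rfl
  rw [this]
  exact isClosed_iInter fun n => isClosed_iInter fun _ =>
    isClosed_eq (coeffCLM F n).continuous continuous_const

end Fourier

variable {E : Type*} [NormedAddCommGroup E] [InnerProductSpace ℂ E] [CompleteSpace E]

/-- An `𝓛(E)`-valued inner function: an element of `H²(𝓛(E))` whose boundary values are
unitary almost everywhere. -/
structure InnerFunction (E : Type*) [NormedAddCommGroup E] [InnerProductSpace ℂ E]
    [CompleteSpace E] where
  bdry : L2 (E →L[ℂ] E)
  mem_hardy : bdry ∈ hardy (E →L[ℂ] E)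
  unitary_ae : ∀ᵐ t ∂arc, bdry t ∈ unitary (E →L[ℂ] E)

theorem aestronglyMeasurable_mul {Φ : Circ → E →L[ℂ] E} {f : Circ → E}
    (hΦ : AEStronglyMeasurable Φ arc) (hf : AEStronglyMeasurable f arc) :
    AEStronglyMeasurable (fun t => Φ t (f t)) arc :=
  (ContinuousLinearMap.id ℂ (E →L[ℂ] E)).aestronglyMeasurable_comp₂ hΦ hf

theorem InnerFunction.norm_apply_ae (Θ : InnerFunction E) :
    ∀ᵐ t ∂arc, ∀ x : E, ‖Θ.bdry t x‖ = ‖x‖ := by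
  filter_upwards [Θ.unitary_ae] with t ht x
  exact ContinuousLinearMap.norm_map_of_mem_unitary ht x

theorem InnerFunction.memLp_mul (Θ : InnerFunction E) {f : Circ → E} (hf : MemLp f 2 arc) :
    MemLp (fun t => Θ.bdry t (f t)) 2 arc := by
  refine hf.of_le (aestronglyMeasurable_mul (Lp.aestronglyMeasurable Θ.bdry) hf.1) ?_
  filter_upwards [Θ.norm_apply_ae] with t ht
  exact (ht _).le

/-- Multiplication by an inner function, `f ↦ Θ f`, on `L²(E)`. -/
def InnerFunction.mul (Θ : InnerFunction E) : L2 E →ₗ[ℂ] L2 E where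
  toFun f := (Θ.memLp_mul (Lp.memLp f)).toLp
  map_add' f g := by
    rw [← MemLp.toLp_add]
    refine MemLp.toLp_congr _ _ ?_
    filter_upwards [Lp.coeFn_add f g] with t ht
    rw [ht, Pi.add_apply, map_add, Pi.add_apply]
  map_smul' c f := by
    rw [RingHom.id_apply, ← MemLp.toLp_const_smul]
    refine MemLp.toLp_congr _ _ ?_
    filter_upwards [Lp.coeFn_smul c f] with t ht
    rw [ht, Pi.smul_apply, map_smul, Pi.smul_apply]

/-- The model space `K_Θ = H²(E) ⊖ Θ H²(E)`. -/
def modelSpace (Θ : InnerFunction E) : Submodule ℂ (L2 E) :=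
  hardy E ⊓ ((hardy E).map Θ.mul)ᗮ

instance (Θ : InnerFunction E) : CompleteSpace (modelSpace Θ) := by
  have h : IsClosed (modelSpace Θ : Set (L2 E)) :=
    isClosed_hardy.inter (Submodule.isClosed_orthogonal _)
  exact h.completeSpace_coe

theorem memLp_mul_of_bounded (Φ : L2 (E →L[ℂ] E)) {f : Circ → E} (hf : MemLp f ⊤ arc) :
    MemLp (fun t => Φ t (f t)) 2 arc := by
  exact (ContinuousLinearMap.id ℂ (E →L[ℂ] E)).memLp_of_bilin 2 (Lp.memLp Φ) hf

/-- `A` is the matrix-valued truncated Toeplitz operator `A_Φ` with symbol `Φ ∈ L²(𝓛(E))`: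
it is bounded on `K_Θ`, and `A f = P_Θ (Φ f)` for every essentially bounded `f ∈ K_Θ`.
(Such `f` are dense in `K_Θ`, so there is at most one such `A`; there is one exactly when
`f ↦ P_Θ (Φ f)` is bounded.) -/
def IsTruncatedToeplitz (Θ : InnerFunction E) (Φ : L2 (E →L[ℂ] E))
    (A : modelSpace Θ →L[ℂ] modelSpace Θ) : Prop :=
  ∀ (f : modelSpace Θ) (hf : MemLp ((f : L2 E) : Circ → E) ⊤ arc),
    A f = (modelSpace Θ).orthogonalProjectionOnto (memLp_mul_of_bounded Φ hf).toLp

theorem memLp_conj (Θ : InnerFunction E) (Γ : Conjugation E) (f : L2 E) :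
    MemLp (fun t => Θ.bdry t ((starRingEnd ℂ) (fourier 1 t) • Γ (f t))) 2 arc := by
  refine Θ.memLp_mul ((Lp.memLp f).of_le ?_ ?_)
  · refine AEStronglyMeasurable.smul ?_ ?_
    · exact (Complex.continuous_conj.comp (map_continuous (fourier 1))).aestronglyMeasurable
    · exact Γ.toLinearIsometry.continuous.comp_aestronglyMeasurable (Lp.aestronglyMeasurable f)
  · filter_upwards with t
    rw [norm_smul, RCLike.norm_conj, norm_fourier_apply, one_mul]
    exact (Γ.toLinearIsometry.norm_map _).le

/-- The map `C_Γ f = Θ z̄ Γ f` on `L²(E)`, that is, `(C_Γ f)(z) = Θ(z) (z̄ Γ(f(z)))`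
for `z = e^{it}`. -/
def conjGamma (Θ : InnerFunction E) (Γ : Conjugation E) (f : L2 E) : L2 E :=
  (memLp_conj Θ Γ f).toLp

end MTTO

end

/-! Since `Θ` is unitary and `Γ`-symmetric, `C_Γ f = Θ z̄ Γ f` satisfies both `Θ* C_Γ f = z̄ Γ f`
and `C_Γ f = z̄ Γ(Θ* f)`. The map `h ↦ z̄ Γ h` reflects frequencies by `n ↦ -n - 1`, exchanging
negative and nonnegative ones. As `K_Θ` is cut out by "`f` has no negative frequency" and "`Θ* f`
has no nonnegative frequency" (`mem_modelSpace_iff`), `C_Γ` swaps the two conditions and so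
preserves `K_Θ`.

For bounded `f, g ∈ K_Θ`, `⟪g, A f⟫` is the integral of `⟪g, Φ f⟫`. Pointwise, `Φ Θ = Θ Φ`,
unitarity of `Θ`, `Φ Γ = Γ Φ*` and antiunitarity of `Γ` give `⟪g, Φ f⟫ = ⟪C f, Φ (C g)⟫`, which is
the weak form of `A = C A* C`. It extends to all of `K_Θ` because bounded functions are dense there
(`dense_boundedModelSpace`). -/

noncomputable section

namespace MTTO

/-! ### Antiunitarity of conjugations -/

namespace Conjugation

variable {H : Type*} [NormedAddCommGroup H] [InnerProductSpace ℂ H] (C : Conjugation H)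

theorem apply_apply (x : H) : C (C x) = x := C.involutive x

theorem re_inner_map_map (x y : H) : (⟪C x, C y⟫_ℂ).re = (⟪x, y⟫_ℂ).re := by
  have h1 := norm_add_sq (𝕜 := ℂ) (C x) (C y)
  have h2 := norm_add_sq (𝕜 := ℂ) x y
  rw [← map_add, C.toLinearIsometry.norm_map, C.toLinearIsometry.norm_map,
    C.toLinearIsometry.norm_map, h2] at h1
  simp only [RCLike.re_eq_complex_re] at h1
  linarith

/-- A conjugation is antiunitary. -/
theorem inner_map_map (x y : H) : ⟪C x, C y⟫_ℂ = ⟪y, x⟫_ℂ := by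
  rw [← inner_conj_symm y x]
  refine Complex.ext ?_ ?_
  · rw [Complex.conj_re, C.re_inner_map_map]
  · have h := C.re_inner_map_map x (Complex.I • y)
    rw [map_smulₛₗ, inner_smul_right, inner_smul_right] at h
    simp at h
    rw [Complex.conj_im]
    linarith

/-- A conjugation as a continuous real-linear map. -/
def toRealCLM (C : Conjugation H) : H →L[ℝ] H :=
  AddMonoidHom.toRealLinearMap (C.toLinearIsometry : H →+ H) C.toLinearIsometry.continuous

variable {C} [CompleteSpace H] {T : H →L[ℂ] H}

theorem IsSymmetric.map_adjoint_apply (h : C.IsSymmetric T) (x : H) :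
    C (ContinuousLinearMap.adjoint T x) = T (C x) := by
  rw [h (C x), C.apply_apply]

end Conjugation

/-! ### Parseval and disjoint spectra -/

section Scalar

variable {E : Type*} [NormedAddCommGroup E] [InnerProductSpace ℂ E] [FiniteDimensional ℂ E]

theorem fourierCoeff_compLp {F G : Type*} [NormedAddCommGroup F] [NormedSpace ℂ F]
    [CompleteSpace F] [NormedAddCommGroup G] [NormedSpace ℂ G] [CompleteSpace G]
    (L : F →L[ℂ] G) (f : L2 F) (n : ℤ) :
    fourierCoeff (L.compLp f) n = L (fourierCoeff f n) := by
  unfold fourierCoeff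
  rw [← L.integral_comp_comm (integrable_fourier_smul f _)]
  refine integral_congr_ae ?_
  filter_upwards [L.coeFn_compLp f] with t ht
  rw [ht, map_smul]

/-- Every term of the Parseval series vanishes. -/
theorem scalar_inner_eq_zero_of_fourierCoeff (g h : L2 ℂ)
    (hgh : ∀ n, fourierCoeff g n = 0 ∨ fourierCoeff h n = 0) : ⟪g, h⟫_ℂ = 0 := by
  have key := (fourierBasis (T := 2 * Real.pi)).hasSum_inner_mul_inner g h
  rw [← key.tsum_eq]
  refine (tsum_congr fun n => ?_).trans tsum_zero
  rcases hgh n with h0 | h0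
  · rw [← inner_conj_symm, ← HilbertBasis.repr_apply_apply, fourierBasis_repr, h0, map_zero,
      zero_mul]
  · rw [mul_comm, ← HilbertBasis.repr_apply_apply, fourierBasis_repr, h0, zero_mul]

/-- Functions with disjoint Fourier spectra are orthogonal. -/
theorem inner_eq_zero_of_fourierCoeff (g h : L2 E)
    (hgh : ∀ n, fourierCoeff g n = 0 ∨ fourierCoeff h n = 0) : ⟪g, h⟫_ℂ = 0 := by
  have := FiniteDimensional.complete ℂ E
  let b := stdOrthonormalBasis ℂ E
  -- Coordinates in an orthonormal basis of `E` reduce the claim to finitely many scalar ones.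
  let p : Fin (Module.finrank ℂ E) → L2 E → L2 ℂ := fun i f => (innerSL ℂ (b i)).compLp f
  have hp : ⟪g, h⟫_ℂ = ∑ i, ⟪p i g, p i h⟫_ℂ := by
    simp only [L2.inner_def]
    rw [← integral_finsetSum _ fun i _ => L2.integrable_inner _ _]
    refine integral_congr_ae ?_
    have h1 : ∀ᵐ t ∂arc, ∀ i, p i g t = ⟪b i, g t⟫_ℂ :=
      ae_all_iff.2 fun i => (innerSL ℂ (b i)).coeFn_compLp g
    have h2 : ∀ᵐ t ∂arc, ∀ i, p i h t = ⟪b i, h t⟫_ℂ :=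
      ae_all_iff.2 fun i => (innerSL ℂ (b i)).coeFn_compLp h
    filter_upwards [h1, h2] with t h1 h2
    rw [← b.sum_inner_mul_inner]
    refine Finset.sum_congr rfl fun i _ => ?_
    rw [h1, h2, RCLike.inner_apply, inner_conj_symm, mul_comm]
  rw [hp]
  refine Finset.sum_eq_zero fun i _ => scalar_inner_eq_zero_of_fourierCoeff _ _ fun n => ?_
  simp only [p, fourierCoeff_compLp]
  exact (hgh n).imp (fun h => by rw [h, map_zero]) (fun h => by rw [h, map_zero])

theorem eq_zero_of_fourierCoeff (f : L2 E) (hf : ∀ n, fourierCoeff f n = 0) : f = 0 :=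
  inner_self_eq_zero (𝕜 := ℂ).1 (inner_eq_zero_of_fourierCoeff f f fun n => Or.inl (hf n))

end Scalar

/-! ### Vector-valued monomials -/

section Monomial

variable {E : Type*} [NormedAddCommGroup E] [InnerProductSpace ℂ E]

theorem memLp_monomial (n : ℤ) (x : E) (p : ENNReal) :
    MemLp (fun t : Circ => (fourier n t : ℂ) • x) p arc := by
  refine MemLp.of_bound ?_ ‖x‖ ?_
  · exact ((map_continuous (fourier n)).smul continuous_const).aestronglyMeasurable
  · filter_upwards with t
    rw [norm_smul, norm_fourier_apply, one_mul]

/-- The monomial `zⁿ x`. -/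
def monomial (n : ℤ) (x : E) : L2 E := (memLp_monomial n x 2).toLp

theorem coeFn_monomial (n : ℤ) (x : E) :
    monomial n x =ᵐ[arc] fun t => (fourier n t : ℂ) • x := MemLp.coeFn_toLp _

theorem memLp_top_monomial (n : ℤ) (x : E) : MemLp (monomial n x : Circ → E) ⊤ arc :=
  (memLp_congr_ae (coeFn_monomial n x)).2 (memLp_monomial n x ⊤)

variable [CompleteSpace E]

/-- Makes monomials test vectors: a Fourier coefficient vanishes once all these pairings do. -/
theorem inner_monomial (n : ℤ) (x : E) (f : L2 E) :
    ⟪monomial n x, f⟫_ℂ = ⟪x, fourierCoeff f n⟫_ℂ := by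
  rw [L2.inner_def, fourierCoeff, ← integral_inner (integrable_fourier_smul f _)]
  refine integral_congr_ae ?_
  filter_upwards [coeFn_monomial n x] with t ht
  rw [ht, inner_smul_left, inner_smul_right, fourier_neg]

theorem fourierCoeff_monomial_of_ne {m n : ℤ} (h : m ≠ n) (x : E) :
    fourierCoeff (monomial n x) m = 0 := by
  refine ext_inner_left ℂ fun y => ?_
  rw [← inner_monomial, inner_zero_right, L2.inner_def]
  have h1 : ∫ t : Circ, (fourier (n - m) t : ℂ) ∂arc = 0 := by
    have h2 : ⟪fourierLp 2 m, fourierLp 2 n⟫_ℂ = 0 := (orthonormal_fourier (T := 2 * Real.pi)).2 h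
    rw [fourierLp, fourierLp, ContinuousMap.inner_toLp] at h2
    rw [← h2]
    refine integral_congr_ae (.of_forall fun t => ?_)
    simp only [← fourier_neg, ← fourier_add, sub_eq_add_neg]
  have h2 : ∫ t : Circ, (fourier (n - m) t : ℂ) * ⟪y, x⟫_ℂ ∂arc = 0 := by
    rw [integral_mul_const, h1, zero_mul]
  rw [← h2]
  refine integral_congr_ae ?_
  filter_upwards [coeFn_monomial n x, coeFn_monomial m y] with t h1 h2
  rw [h1, h2, inner_smul_left, inner_smul_right, ← fourier_neg, ← mul_assoc, ← fourier_add,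
    neg_add_eq_sub]

theorem fourierCoeff_monomial_self (n : ℤ) (x : E) : fourierCoeff (monomial n x) n = x := by
  have h : ∀ t : Circ, (fourier (-n) t : ℂ) • ((fourier n t : ℂ) • x) = x := fun t => by
    rw [smul_smul, ← fourier_add, neg_add_cancel, fourier_zero, one_smul]
  unfold fourierCoeff
  rw [integral_congr_ae (g := fun _ => x)]
  · simp
  · filter_upwards [coeFn_monomial n x] with t ht
    rw [ht, h]

end Monomial

/-! ### Multiplication by `Θ*` and the spectral description of `K_Θ` -/

variable {E : Type*} [NormedAddCommGroup E] [InnerProductSpace ℂ E] [CompleteSpace E]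

theorem InnerFunction.coeFn_mul (Θ : InnerFunction E) (f : L2 E) :
    Θ.mul f =ᵐ[arc] fun t => Θ.bdry t (f t) :=
  (Θ.memLp_mul (Lp.memLp f)).coeFn_toLp

theorem InnerFunction.memLp_adjoint_mul (Θ : InnerFunction E) (f : L2 E) :
    MemLp (fun t => ContinuousLinearMap.adjoint (Θ.bdry t) (f t)) 2 arc := by
  refine (Lp.memLp f).of_le (aestronglyMeasurable_mul ?_ (Lp.aestronglyMeasurable f)) ?_
  · exact (ContinuousLinearMap.adjoint (𝕜 := ℂ) (E := E) (F := E)).continuous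
      |>.comp_aestronglyMeasurable (Lp.aestronglyMeasurable Θ.bdry)
  · filter_upwards [Θ.unitary_ae] with t ht
    exact (ContinuousLinearMap.norm_map_of_mem_unitary (Unitary.star_mem ht) _).le

/-- Multiplication by the adjoint of an inner function, `f ↦ Θ* f`, on `L²(E)`. -/
def InnerFunction.adjointMul (Θ : InnerFunction E) (f : L2 E) : L2 E :=
  (Θ.memLp_adjoint_mul f).toLp

theorem InnerFunction.coeFn_adjointMul (Θ : InnerFunction E) (f : L2 E) :
    Θ.adjointMul f =ᵐ[arc] fun t => ContinuousLinearMap.adjoint (Θ.bdry t) (f t) :=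
  MemLp.coeFn_toLp _

theorem InnerFunction.inner_mul_left (Θ : InnerFunction E) (f g : L2 E) :
    ⟪Θ.mul f, g⟫_ℂ = ⟪f, Θ.adjointMul g⟫_ℂ := by
  rw [L2.inner_def, L2.inner_def]
  refine integral_congr_ae ?_
  filter_upwards [Θ.coeFn_mul f, Θ.coeFn_adjointMul g] with t h1 h2
  rw [h1, h2, ContinuousLinearMap.adjoint_inner_right]

theorem adjoint_apply_apply_of_mem_unitary {U : E →L[ℂ] E} (hU : U ∈ unitary (E →L[ℂ] E)) (x : E) :
    ContinuousLinearMap.adjoint U (U x) = x :=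
  congrArg (fun V : E →L[ℂ] E => V x) (Unitary.mem_iff.1 hU).1

theorem InnerFunction.adjointMul_mul (Θ : InnerFunction E) (f : L2 E) :
    Θ.adjointMul (Θ.mul f) = f := by
  refine Lp.ext ?_
  filter_upwards [Θ.coeFn_mul f, Θ.coeFn_adjointMul (Θ.mul f), Θ.unitary_ae] with t h1 h2 hU
  rw [h2, h1, adjoint_apply_apply_of_mem_unitary hU]

theorem InnerFunction.adjointMul_sub (Θ : InnerFunction E) (f g : L2 E) :
    Θ.adjointMul (f - g) = Θ.adjointMul f - Θ.adjointMul g :=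
  ext_inner_left ℂ fun h => by
    rw [inner_sub_right, ← Θ.inner_mul_left, ← Θ.inner_mul_left, ← Θ.inner_mul_left,
      inner_sub_right]

/-- `K_Θ` consists of the `f ∈ H²(E)` such that `Θ* f` has only negative frequencies. -/
theorem mem_modelSpace_iff [FiniteDimensional ℂ E] (Θ : InnerFunction E) (f : L2 E) :
    f ∈ modelSpace Θ ↔ f ∈ hardy E ∧ ∀ n : ℤ, 0 ≤ n → fourierCoeff (Θ.adjointMul f) n = 0 := by
  refine and_congr_right fun _ => ?_
  constructor
  · intro hf n hn
    refine ext_inner_left ℂ fun x => ?_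
    rw [← inner_monomial, ← Θ.inner_mul_left, inner_zero_right]
    -- For `n ≥ 0`, `zⁿ x` lies in `H²(E)`, so `Θ zⁿ x` is an admissible test vector.
    exact hf _ ⟨monomial n x, fun m hm => fourierCoeff_monomial_of_ne (by omega) x, rfl⟩
  · rintro hf _ ⟨h, hh, rfl⟩
    rw [Θ.inner_mul_left]
    refine inner_eq_zero_of_fourierCoeff _ _ fun n => ?_
    exact (lt_or_ge n 0).imp (hh n) (hf n)

/-! ### Density of bounded functions in `K_Θ` -/

section Density

theorem InnerFunction.memLp_top_mul (Θ : InnerFunction E) {f : L2 E}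
    (hf : MemLp (f : Circ → E) ⊤ arc) : MemLp (Θ.mul f : Circ → E) ⊤ arc := by
  refine hf.of_le (Lp.aestronglyMeasurable _) ?_
  filter_upwards [Θ.coeFn_mul f, Θ.norm_apply_ae] with t h1 h2
  rw [h1, h2]

/-- The essentially bounded functions in `L²(E)`. -/
def boundedL2 (E : Type*) [NormedAddCommGroup E] [InnerProductSpace ℂ E] :
    Submodule ℂ (L2 E) where
  carrier := {f | MemLp (f : Circ → E) ⊤ arc}
  add_mem' {f g} hf hg := (memLp_congr_ae (Lp.coeFn_add f g)).2 (MemLp.add hf hg)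
  zero_mem' := (memLp_congr_ae (Lp.coeFn_zero E 2 arc)).2 MemLp.zero
  smul_mem' c f hf := (memLp_congr_ae (Lp.coeFn_smul c f)).2 (MemLp.const_smul hf c)

theorem fourierCoeff_mul_monomial (Θ : InnerFunction E) (k n : ℤ) (x : E) :
    fourierCoeff (Θ.mul (monomial k x)) n = fourierCoeff Θ.bdry (n - k) x := by
  unfold fourierCoeff
  refine Eq.trans ?_
    (ContinuousLinearMap.integral_apply (integrable_fourier_smul Θ.bdry (-(n - k))) x).symm
  refine integral_congr_ae ?_
  filter_upwards [Θ.coeFn_mul (monomial k x), coeFn_monomial k x] with t h1 h2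
  rw [h1, h2, map_smul, smul_smul, ← fourier_add, smul_apply, neg_sub,
    neg_add_eq_sub]

/-- Pair with `zᵐ y` and move `Θ*` across: `Θ zᵐ y` has no frequency below `m`, as `Θ` is analytic.
Hence the nonnegative part of `Θ* zⁿ x` is a polynomial, and so bounded. -/
theorem fourierCoeff_adjointMul_monomial_of_lt (Θ : InnerFunction E) {m n : ℤ} (h : n < m)
    (x : E) : fourierCoeff (Θ.adjointMul (monomial n x)) m = 0 := by
  refine ext_inner_left ℂ fun y => ?_
  rw [← inner_monomial, ← Θ.inner_mul_left, ← inner_conj_symm, inner_monomial,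
    fourierCoeff_mul_monomial, Θ.mem_hardy _ (by omega), zero_apply,
    inner_zero_right, inner_zero_right, map_zero]

/-- The part of `Θ* zⁿ x` with nonnegative frequencies. -/
def analyticPart (Θ : InnerFunction E) (n : ℕ) (x : E) : L2 E :=
  ∑ k ∈ Finset.range (n + 1),
    monomial (k : ℤ) (fourierCoeff (Θ.adjointMul (monomial n x)) (k : ℤ))

theorem fourierCoeff_analyticPart (Θ : InnerFunction E) (n : ℕ) (x : E) {m : ℤ} (hm : 0 ≤ m) :
    fourierCoeff (analyticPart Θ n x) m = fourierCoeff (Θ.adjointMul (monomial n x)) m := by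
  lift m to ℕ using hm
  change coeffCLM E m (analyticPart Θ n x) = _
  rw [analyticPart, map_sum]
  by_cases hmn : m ≤ n
  · rw [Finset.sum_eq_single_of_mem m (Finset.mem_range.2 (by omega))]
    · exact fourierCoeff_monomial_self _ _
    · exact fun k _ hk => fourierCoeff_monomial_of_ne (by exact_mod_cast hk.symm) _
  · rw [fourierCoeff_adjointMul_monomial_of_lt Θ (by omega)]
    refine Finset.sum_eq_zero fun k hk => fourierCoeff_monomial_of_ne ?_ _
    have := Finset.mem_range.1 hk
    omega

/-- The projection `zⁿ x - Θ p` of the monomial `zⁿ x` to `K_Θ`. -/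
def modelMonomial (Θ : InnerFunction E) (n : ℕ) (x : E) : L2 E :=
  monomial n x - Θ.mul (analyticPart Θ n x)

theorem modelMonomial_mem_bounded (Θ : InnerFunction E) (n : ℕ) (x : E) :
    modelMonomial Θ n x ∈ boundedL2 E := by
  refine Submodule.sub_mem _ (memLp_top_monomial _ _) (Θ.memLp_top_mul ?_)
  exact Submodule.sum_mem (boundedL2 E) fun k _ => memLp_top_monomial _ _

theorem analyticPart_mem_hardy (Θ : InnerFunction E) (n : ℕ) (x : E) :
    analyticPart Θ n x ∈ hardy E :=
  Submodule.sum_mem _ fun k _ m hm => fourierCoeff_monomial_of_ne (by omega) _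

theorem mul_analyticPart_mem_hardy (Θ : InnerFunction E) (n : ℕ) (x : E) :
    Θ.mul (analyticPart Θ n x) ∈ hardy E := by
  rw [analyticPart, map_sum]
  refine Submodule.sum_mem _ fun k _ m hm => ?_
  rw [fourierCoeff_mul_monomial, Θ.mem_hardy _ (by omega), zero_apply]

theorem modelMonomial_mem_modelSpace [FiniteDimensional ℂ E] (Θ : InnerFunction E) (n : ℕ)
    (x : E) : modelMonomial Θ n x ∈ modelSpace Θ := by
  rw [mem_modelSpace_iff]
  constructor
  · refine Submodule.sub_mem _ (fun m hm => fourierCoeff_monomial_of_ne (by omega) _) ?_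
    exact mul_analyticPart_mem_hardy Θ n x
  · intro m hm
    rw [modelMonomial, Θ.adjointMul_sub, Θ.adjointMul_mul]
    change coeffCLM E m (_ - _) = 0
    rw [map_sub, sub_eq_zero]
    exact (fourierCoeff_analyticPart Θ n x hm).symm

/-- The essentially bounded functions in `K_Θ`. -/
def boundedModelSpace (Θ : InnerFunction E) : Submodule ℂ (modelSpace Θ) :=
  (boundedL2 E).comap (modelSpace Θ).subtype

/-- An `f ∈ K_Θ` orthogonal to every bounded `zⁿ x - Θ p` in `K_Θ` is orthogonal to `zⁿ x`, because
`f ⊥ Θ H²(E)`. Its nonnegative coefficients therefore vanish along with the negative ones. -/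
theorem dense_boundedModelSpace [FiniteDimensional ℂ E] (Θ : InnerFunction E) :
    Dense (boundedModelSpace Θ : Set (modelSpace Θ)) := by
  rw [Submodule.dense_iff_topologicalClosure_eq_top, Submodule.topologicalClosure_eq_top_iff,
    Submodule.eq_bot_iff]
  rintro ⟨f, hf⟩ hperp
  refine Subtype.ext (eq_zero_of_fourierCoeff f fun n => ?_)
  rcases lt_or_ge n 0 with hn | hn
  · exact hf.1 n hn
  · lift n to ℕ using hn
    refine ext_inner_left ℂ fun x => ?_
    have h1 : ⟪modelMonomial Θ n x, f⟫_ℂ = 0 :=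
      hperp ⟨_, modelMonomial_mem_modelSpace Θ n x⟩ (modelMonomial_mem_bounded Θ n x)
    have h2 : ⟪Θ.mul (analyticPart Θ n x), f⟫_ℂ = 0 :=
      hf.2 _ ⟨_, analyticPart_mem_hardy Θ n x, rfl⟩
    rw [modelMonomial, inner_sub_left, h2, sub_zero, inner_monomial] at h1
    rw [h1, inner_zero_right]

end Density

/-! ### The conjugation `C_Γ` on `K_Θ` -/

section Conj

variable (Θ : InnerFunction E) (Γ : Conjugation E)

theorem coeFn_conjGamma (f : L2 E) :
    conjGamma Θ Γ f =ᵐ[arc]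
      fun t => Θ.bdry t ((starRingEnd ℂ) (fourier 1 t) • Γ (f t)) := MemLp.coeFn_toLp _

/-- Conjugate-linearity of `Γ` reverses frequencies, and `z̄` shifts them by `-1`; this shift makes
the reflection exchange `n < 0` with `n ≥ 0` exactly. -/
theorem fourierCoeff_conj (f : L2 E) (n : ℤ) :
    fourierCoeff (fun t : Circ => (starRingEnd ℂ) (fourier 1 t : ℂ) • Γ (f t)) n =
      Γ (fourierCoeff f (-n - 1)) := by
  unfold fourierCoeff
  -- Real-linearity is enough to pull `Γ` through the integral.
  change _ = Γ.toRealCLM (∫ t : Circ, (fourier (-(-n - 1)) t : ℂ) • f t ∂arc)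
  rw [← Γ.toRealCLM.integral_comp_comm (integrable_fourier_smul f _)]
  refine integral_congr_ae (.of_forall fun t => ?_)
  change _ = Γ ((fourier (-(-n - 1)) t : ℂ) • f t)
  rw [map_smulₛₗ]
  simp only [smul_smul, ← fourier_neg, ← fourier_add]
  congr 3
  ring

theorem adjointMul_conjGamma_ae (f : L2 E) :
    Θ.adjointMul (conjGamma Θ Γ f) =ᵐ[arc]
      fun t => (starRingEnd ℂ) (fourier 1 t : ℂ) • Γ (f t) := by
  filter_upwards [Θ.coeFn_adjointMul (conjGamma Θ Γ f), coeFn_conjGamma Θ Γ f, Θ.unitary_ae]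
    with t h1 h2 hU
  rw [h1, h2, adjoint_apply_apply_of_mem_unitary hU]

theorem norm_conjGamma (f : L2 E) : ‖conjGamma Θ Γ f‖ = ‖f‖ := by
  rw [Lp.norm_def, Lp.norm_def]
  congr 1
  refine eLpNorm_congr_norm_ae ?_
  filter_upwards [coeFn_conjGamma Θ Γ f, Θ.norm_apply_ae] with t h1 h2
  rw [h1, h2, norm_smul, RCLike.norm_conj, norm_fourier_apply, one_mul]
  exact Γ.toLinearIsometry.norm_map _

theorem memLp_top_conjGamma {f : L2 E} (hf : MemLp (f : Circ → E) ⊤ arc) :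
    MemLp (conjGamma Θ Γ f : Circ → E) ⊤ arc := by
  refine hf.of_le (Lp.aestronglyMeasurable _) ?_
  filter_upwards [coeFn_conjGamma Θ Γ f, Θ.norm_apply_ae] with t h1 h2
  rw [h1, h2, norm_smul, RCLike.norm_conj, norm_fourier_apply, one_mul]
  exact (Γ.toLinearIsometry.norm_map _).le

theorem conjGamma_add (f g : L2 E) :
    conjGamma Θ Γ (f + g) = conjGamma Θ Γ f + conjGamma Θ Γ g := by
  refine Lp.ext ?_
  filter_upwards [coeFn_conjGamma Θ Γ f, coeFn_conjGamma Θ Γ g, coeFn_conjGamma Θ Γ (f + g),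
    Lp.coeFn_add f g, Lp.coeFn_add (conjGamma Θ Γ f) (conjGamma Θ Γ g)] with t h1 h2 h3 h4 h5
  rw [h3, h5, h4, Pi.add_apply, Pi.add_apply, h1, h2, map_add, smul_add, map_add]

theorem conjGamma_smul (c : ℂ) (f : L2 E) :
    conjGamma Θ Γ (c • f) = (starRingEnd ℂ) c • conjGamma Θ Γ f := by
  refine Lp.ext ?_
  filter_upwards [coeFn_conjGamma Θ Γ f, coeFn_conjGamma Θ Γ (c • f),
    Lp.coeFn_smul c f, Lp.coeFn_smul ((starRingEnd ℂ) c) (conjGamma Θ Γ f)] with t h1 h2 h3 h4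
  rw [h2, h4, h3, Pi.smul_apply, Pi.smul_apply, h1,
    Γ.toLinearIsometry.map_smulₛₗ, smul_comm, map_smul]

variable {Θ Γ}

/-- Symmetry of `Θ` in the form `Θ Γ = Γ Θ*`. Together with `adjointMul_conjGamma_ae` it yields both
involutivity and invariance of `K_Θ`. -/
theorem conjGamma_ae_of_isSymmetric (hΘ : ∀ᵐ t ∂arc, Γ.IsSymmetric (Θ.bdry t)) (f : L2 E) :
    conjGamma Θ Γ f =ᵐ[arc]
      fun t => (starRingEnd ℂ) (fourier 1 t : ℂ) • Γ (Θ.adjointMul f t) := by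
  filter_upwards [coeFn_conjGamma Θ Γ f, Θ.coeFn_adjointMul f, hΘ] with t h1 h2 h3
  rw [h1, h2, map_smul, h3.map_adjoint_apply]

theorem conjGamma_conjGamma (hΘ : ∀ᵐ t ∂arc, Γ.IsSymmetric (Θ.bdry t)) (f : L2 E) :
    conjGamma Θ Γ (conjGamma Θ Γ f) = f := by
  refine Lp.ext ?_
  filter_upwards [conjGamma_ae_of_isSymmetric hΘ (conjGamma Θ Γ f),
    adjointMul_conjGamma_ae Θ Γ f] with t h1 h2
  rw [h1, h2, map_smulₛₗ, Γ.apply_apply, smul_smul, Complex.conj_conj, ← fourier_neg,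
    ← fourier_add, neg_add_cancel, fourier_zero, one_smul]

theorem conjGamma_mem_modelSpace [FiniteDimensional ℂ E]
    (hΘ : ∀ᵐ t ∂arc, Γ.IsSymmetric (Θ.bdry t)) {f : L2 E} (hf : f ∈ modelSpace Θ) :
    conjGamma Θ Γ f ∈ modelSpace Θ := by
  rw [mem_modelSpace_iff] at hf ⊢
  refine ⟨fun n hn => ?_, fun n hn => ?_⟩
  · rw [fourierCoeff_congr_ae (conjGamma_ae_of_isSymmetric hΘ f), fourierCoeff_conj,
      hf.2 _ (by omega), map_zero]
  · rw [fourierCoeff_congr_ae (adjointMul_conjGamma_ae Θ Γ f), fourierCoeff_conj,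
      hf.1 _ (by omega), map_zero]

/-- The restriction of `C_Γ` to a conjugation on `K_Θ`. -/
def modelConjugation [FiniteDimensional ℂ E] (hΘ : ∀ᵐ t ∂arc, Γ.IsSymmetric (Θ.bdry t)) :
    Conjugation (modelSpace Θ) where
  toFun f := ⟨conjGamma Θ Γ f, conjGamma_mem_modelSpace hΘ f.2⟩
  map_add' f g := Subtype.ext (conjGamma_add Θ Γ f g)
  map_smul' c f := Subtype.ext (conjGamma_smul Θ Γ c f)
  norm_map' f := norm_conjGamma Θ Γ f
  involutive f := Subtype.ext (conjGamma_conjGamma hΘ f)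

/-- The projection is self-adjoint and fixes `g`, so it drops out of the pairing; only `f` has to be
bounded. -/
theorem IsTruncatedToeplitz.inner_apply {Φ : L2 (E →L[ℂ] E)}
    {A : modelSpace Θ →L[ℂ] modelSpace Θ} (hA : IsTruncatedToeplitz Θ Φ A) {f : modelSpace Θ}
    (hf : MemLp ((f : L2 E) : Circ → E) ⊤ arc) (g : modelSpace Θ) :
    ⟪g, A f⟫_ℂ = ∫ t, ⟪(g : L2 E) t, Φ t ((f : L2 E) t)⟫_ℂ ∂arc := by
  rw [hA f hf, Submodule.coe_inner, Submodule.coe_orthogonalProjectionOnto_apply,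
    ← Submodule.inner_starProjection_left_eq_right,
    Submodule.starProjection_eq_self_iff.2 g.2, L2.inner_def]
  refine integral_congr_ae ?_
  filter_upwards [(memLp_mul_of_bounded Φ hf).coeFn_toLp] with t ht
  rw [ht]

end Conj

end MTTO

end

/-! ### Symmetry of the truncated Toeplitz operator -/

open MTTO in
theorem mainTheorem9 {E : Type*} [NormedAddCommGroup E] [InnerProductSpace ℂ E]
    [CompleteSpace E] [FiniteDimensional ℂ E]
    (Θ : MTTO.InnerFunction E) (Γ : MTTO.Conjugation E) (Φ : MTTO.L2 (E →L[ℂ] E))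
    (hΘ : ∀ᵐ t ∂MTTO.arc, Γ.IsSymmetric (Θ.bdry t))
    (hΦ : ∀ᵐ t ∂MTTO.arc, Γ.IsSymmetric (Φ t))
    (hcomm : ∀ᵐ t ∂MTTO.arc, Φ t ∘L Θ.bdry t = Θ.bdry t ∘L Φ t)
    (A : MTTO.modelSpace Θ →L[ℂ] MTTO.modelSpace Θ)
    (hA : MTTO.IsTruncatedToeplitz Θ Φ A) :
    ∃ C : MTTO.Conjugation (MTTO.modelSpace Θ),
      (∀ f : MTTO.modelSpace Θ, (C f : MTTO.L2 E) = MTTO.conjGamma Θ Γ f) ∧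
        C.IsSymmetric A := by
  let C := modelConjugation hΘ
  refine ⟨C, fun f => rfl, ?_⟩
  have hC : Continuous C := C.toLinearIsometry.continuous
  have key : ∀ f ∈ boundedModelSpace Θ, ∀ g ∈ boundedModelSpace Θ,
      ⟪g, A f⟫_ℂ = ⟪C f, A (C g)⟫_ℂ := by
    intro f hf g hg
    rw [hA.inner_apply hf, hA.inner_apply (f := C g) (memLp_top_conjGamma Θ Γ hg)]
    refine integral_congr_ae ?_
    filter_upwards [coeFn_conjGamma Θ Γ f, coeFn_conjGamma Θ Γ g, hΦ, hcomm, Θ.unitary_ae]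
      with t h1 h2 h3 h4 hU
    change _ = ⟪conjGamma Θ Γ f t, Φ t (conjGamma Θ Γ g t)⟫_ℂ
    have h5 : ∀ x, Φ t (Θ.bdry t x) = Θ.bdry t (Φ t x) :=
      fun x => congrArg (fun S : E →L[ℂ] E => S x) h4
    -- `Θ` passes to the left of `Φ` and cancels against its adjoint, and the two factors `z̄`
    -- cancel in the inner product. What remains is `⟪Γ f, Φ (Γ g)⟫ = ⟪Γ f, Γ (Φ* g)⟫ = ⟪Φ* g, f⟫`.
    rw [h1, h2, h5, ← ContinuousLinearMap.adjoint_inner_right,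
      adjoint_apply_apply_of_mem_unitary hU, map_smul, inner_smul_left, inner_smul_right,
      Complex.conj_conj, ← mul_assoc, ← fourier_neg, ← fourier_add, add_neg_cancel, fourier_zero,
      one_mul, ← h3.map_adjoint_apply, Γ.inner_map_map,
      ContinuousLinearMap.adjoint_inner_left]
  have hd := dense_boundedModelSpace Θ
  refine congrFun (Continuous.ext_on hd A.continuous
    (hC.comp ((ContinuousLinearMap.adjoint A).continuous.comp hC)) fun f hf => ?_)
  refine hd.eq_of_inner_right ℂ fun g hg => ?_
  -- Antiunitarity rewrites `⟪g, C A* C f⟫` as `⟪C f, A (C g)⟫`, the right-hand side of `key`.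
  have h := C.inner_map_map (C g) (ContinuousLinearMap.adjoint A (C f))
  rw [C.apply_apply, ContinuousLinearMap.adjoint_inner_left] at h
  exact (key f hf g hg).trans h.symm
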